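/- There is an absolute constant $K$ such that the following holds for every integer $k\ge 1$ and all non-negative real weights $w_1,\dots,w_k$. There is a constant $c'$, depending only on $k$ and $w_1,\dots,w_k$, such that for all pairwise disjoint non-empty sets $M_1,\dots,M_k$, where any two distinct points of $M_\ell$ are at distance $w_\ell$, and every initial server configuration $C_0\in M_1\times\cdots\times M_k$, there is a randomized online algorithm for the generalized $k$-server problem on $M_1,\dots,M_k$, starting at $C_0$, that satisfies $$\mathrm{ALG}(\rho)\le \exp(K k^2)\cdot \mathrm{OPT}(\rho)+c'$$ for every finite sequence $\rho=r_1\cdots r_m$ of requests $r_i\in M_1\times\cdots\times M_k$. In other words, there is an $\exp(O(k^2))$-competitive randomized online algorithm for the generalized $k$-server problem on weighted uniform metrics. Here a server configuration is a tuple $C\in M_1\times\cdots\times M_k$ (one server in each $M_\ell$); it satisfies a request $r$ if $C[\ell]=r[\ell]$ for at least one $\ell$; moving from $C$ to $C'$ costs $\sum_{\ell=1}^k w_\ell\cdot\mathbb{I}[C[\ell]\ne C'[\ell]]$. A solution to $\rho$ is a sequence of configurations $C_0,C_1,\dots,C_m$, where $C_0$ is arbitrary and $C_i$ satisfies $r_i$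 for each $i\in\{1,\dots,m\}$; its cost is the sum of the costs of its $m$ moves, and $\mathrm{OPT}(\rho)$ is the minimum cost of a solution. A randomized online algorithm always satisfies the current request, its random choices depend only on the requests seen so far and its earlier random choices, and $\mathrm{ALG}(\rho)$ is its expected total movement cost on $\rho$. -/

import Mathlib

open scoped NNReal ENNReal

universe u

namespace GeneralizedKServer

/-- The uniform metric scaled by a weight: two distinct points are at distance `w`. -/
noncomputable def uniformDist {X : Type u} (w : ℝ≥0) (p q : X) : ℝ≥0 :=
  open Classical in if p = q then 0 else w

/-- A server configuration: one point in each of the `k` spaces. The spaces are the members of an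
indexed family of types, hence pairwise disjoint. -/
abbrev Config {k : ℕ} (M : Fin k → Type u) : Type u := ∀ l, M l

/-- A request: a tuple with one point in each of the `k` spaces. -/
abbrev Request {k : ℕ} (M : Fin k → Type u) : Type u := ∀ l, M l

/-- A configuration satisfies a request if it covers it in at least one coordinate. -/
def Satisfies {k : ℕ} {M : Fin k → Type u} (C : Config M) (r : Request M) : Prop :=
  ∃ l, C l = r l

/-- The cost of moving the servers from configuration `C` to configuration `C'`. -/
noncomputable def moveCost {k : ℕ} {M : Fin k → Type u} (w : Fin k → ℝ≥0) (C C' : Config M) :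
    ℝ≥0 :=
  ∑ l, uniformDist (w l) (C l) (C' l)

/-- A sequence of configurations `C₀, C₁, …, Cₘ` is a solution to `r₁ ⋯ rₘ` if `Cᵢ` satisfies
`rᵢ` for each `i ∈ {1, …, m}`. The configuration `C₀` is arbitrary. -/
def IsSolution {k : ℕ} {M : Fin k → Type u} (ρ : List (Request M))
    (C : Fin (ρ.length + 1) → Config M) : Prop :=
  ∀ i : Fin ρ.length, Satisfies (C i.succ) (ρ.get i)

/-- The total movement cost of a sequence of configurations. -/
noncomputable def solutionCost {k : ℕ} {M : Fin k → Type u} (w : Fin k → ℝ≥0) {m : ℕ}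
    (C : Fin (m + 1) → Config M) : ℝ≥0 :=
  ∑ i : Fin m, moveCost w (C i.castSucc) (C i.succ)

/-- The optimal offline cost of a request sequence. (An infimum of finitely many values.) -/
noncomputable def OPT {k : ℕ} {M : Fin k → Type u} (w : Fin k → ℝ≥0) (ρ : List (Request M)) :
    ℝ≥0∞ :=
  ⨅ (C : Fin (ρ.length + 1) → Config M) (_ : IsSolution ρ C), (solutionCost w C : ℝ≥0∞)

/-- A randomized online algorithm whose servers start at `C₀`. It has a memory of arbitrary
type (which includes the current positions of its servers). When a request arrives, it draws a new
memory state at random, with a law that depends on the current memory and the request only, in such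
a way that the new positions of the servers satisfy the request. -/
structure RandomizedOnlineAlgorithm {k : ℕ} (M : Fin k → Type u) (C₀ : Config M) where
  /-- the states of the memory -/
  Memory : Type u
  /-- the positions of the servers -/
  config : Memory → Config M
  /-- the initial memory -/
  start : Memory
  /-- the random reaction to a request -/
  next : Memory → Request M → PMF Memory
  config_start : config start = C₀
  satisfies_next : ∀ m r, ∀ m' ∈ (next m r).support, Satisfies (config m') r

namespace RandomizedOnlineAlgorithm

/-- The expected total movement cost incurred by the algorithm when it serves a finite sequence of
requests starting with memory `m`. -/
noncomputable def expectedCostFrom {k : ℕ} {M : Fin k → Type u} {C₀ : Config M}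
    (A : RandomizedOnlineAlgorithm M C₀) (w : Fin k → ℝ≥0) :
    A.Memory → List (Request M) → ℝ≥0∞
  | _, [] => 0
  | m, r :: ρ => ∑' m', A.next m r m' *
      ((moveCost w (A.config m) (A.config m') : ℝ≥0∞) + expectedCostFrom A w m' ρ)

/-- The expected cost `ALG(ρ)` of the algorithm on the request sequence `ρ`. -/
noncomputable def expectedCost {k : ℕ} {M : Fin k → Type u} {C₀ : Config M}
    (A : RandomizedOnlineAlgorithm M C₀) (w : Fin k → ℝ≥0) (ρ : List (Request M)) : ℝ≥0∞ :=
  A.expectedCostFrom w A.start ρ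

end RandomizedOnlineAlgorithm

end GeneralizedKServer

/-! The servers are added in order of increasing weight: an algorithm for a set `s` of m lighter
servers is extended by a heaviest server a. Time is cut into phases. A position p of a is alive
while the requests of the phase with coordinate a different from p can be served by `s` at cost
below w_a. A phase ends only when no position is alive, so every offline solution pays at least w_a
for it, either by moving a or by moving `s` (`mul_phaseCount_le_optOn`).

Online, a first rests while the recursive algorithm serves everything, until the optimum of `s` on
the phase exceeds 4^m w_a. From then on fewer than `errDen m` positions are alive
(`card_lt_errDen`), and a sits at a uniformly random alive position, redrawn whenever it dies. The
expected number of redraws is logarithmic in the number of alive positions, hence O(2^m)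
(`changeCost_le`). The recursive algorithm restarts with each candidate and only sees requests of
offline optimum at most 4^m w_a (`PartialAlgorithm.compose_costFrom_le`). One level thus multiplies
the ratio by at most 20 * 8^m, and k levels give exp(O(k^2)).

The crux is `combinable`: if every request is missed by at most a 1/`errDen m` fraction of a family
of solutions, one solution serves everything at 4^m times their average cost. Solutions belonging to
different alive positions miss a request at most once in total, so `errDen m` of them would combine
into a solution within the threshold, which has already been exceeded. -/

namespace GeneralizedKServer

/-! ### Costs and offline optima for a subset of the servers -/

variable {k : ℕ} {M : Fin k → Type u}

/-- A configuration satisfies a request by means of one of the servers in `s`. -/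
def SatisfiesOn (s : Finset (Fin k)) (C : Config M) (r : Request M) : Prop :=
  ∃ l ∈ s, C l = r l

/-- The cost of moving the servers in `s` from configuration `C` to configuration `C'`. -/
noncomputable def moveCostOn (s : Finset (Fin k)) (w : Fin k → ℝ≥0) (C C' : Config M) : ℝ≥0 :=
  ∑ l ∈ s, uniformDist (w l) (C l) (C' l)

theorem uniformDist_self {X : Type u} (w : ℝ≥0) (p : X) : uniformDist w p p = 0 := by
  simp [uniformDist]

theorem uniformDist_of_ne {X : Type u} (w : ℝ≥0) {p q : X} (h : p ≠ q) :
    uniformDist w p q = w := by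
  simp [uniformDist, h]

theorem uniformDist_le {X : Type u} (w : ℝ≥0) (p q : X) : uniformDist w p q ≤ w := by
  unfold uniformDist
  split_ifs <;> simp

theorem uniformDist_triangle {X : Type u} (w : ℝ≥0) (p q r : X) :
    uniformDist w p r ≤ uniformDist w p q + uniformDist w q r := by
  by_cases h : p = q
  · subst h
    simp [uniformDist_self]
  · rw [uniformDist_of_ne w h]
    exact (uniformDist_le w p r).trans le_self_add

section moveCostOn

variable (s : Finset (Fin k)) (w : Fin k → ℝ≥0)

theorem moveCostOn_self (C : Config M) : moveCostOn s w C C = 0 := by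
  simp [moveCostOn, uniformDist_self]

theorem moveCostOn_triangle (C C' C'' : Config M) :
    moveCostOn s w C C'' ≤ moveCostOn s w C C' + moveCostOn s w C' C'' := by
  unfold moveCostOn
  rw [← Finset.sum_add_distrib]
  exact Finset.sum_le_sum fun l _ => uniformDist_triangle _ _ _ _

theorem moveCostOn_insert {a : Fin k} (ha : a ∉ s) (C C' : Config M) :
    moveCostOn (insert a s) w C C' = uniformDist (w a) (C a) (C' a) + moveCostOn s w C C' :=
  Finset.sum_insert ha

theorem moveCostOn_update {a : Fin k} (ha : a ∉ s) (C C' : Config M) (p q : M a) :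
    moveCostOn s w (Function.update C a p) (Function.update C' a q) = moveCostOn s w C C' := by
  refine Finset.sum_congr rfl fun l hl => ?_
  have : l ≠ a := fun h => ha (h ▸ hl)
  simp [this]

theorem moveCostOn_le_card_mul {W : ℝ≥0} (hW : ∀ l ∈ s, w l ≤ W) (C C' : Config M) :
    moveCostOn s w C C' ≤ s.card * W := by
  rw [← nsmul_eq_mul]
  exact Finset.sum_le_card_nsmul _ _ _ fun l hl => (uniformDist_le _ _ _).trans (hW l hl)

end moveCostOn

theorem SatisfiesOn.update_iff {s : Finset (Fin k)} {a : Fin k} (ha : a ∉ s) {C : Config M}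
    {p : M a} {r : Request M} :
    SatisfiesOn s (Function.update C a p) r ↔ SatisfiesOn s C r := by
  refine exists_congr fun l => and_congr_right fun hl => ?_
  have : l ≠ a := fun h => ha (h ▸ hl)
  simp [this]

theorem satisfiesOn_insert {s : Finset (Fin k)} {a : Fin k} {C : Config M} {r : Request M} :
    SatisfiesOn (insert a s) C r ↔ C a = r a ∨ SatisfiesOn s C r := by
  simp [SatisfiesOn]

/-- The optimal offline cost of serving requests with the servers in `s`, starting at `C`. -/
noncomputable def optFrom (s : Finset (Fin k)) (w : Fin k → ℝ≥0) :
    Config M → List (Request M) → ℝ≥0∞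
  | _, [] => 0
  | C, r :: ρ => ⨅ (C' : Config M) (_ : SatisfiesOn s C' r),
      (moveCostOn s w C C' : ℝ≥0∞) + optFrom s w C' ρ

/-- The optimal offline cost of serving requests with the servers in `s`, with a free choice of
the initial configuration. -/
noncomputable def optOn (s : Finset (Fin k)) (w : Fin k → ℝ≥0) (ρ : List (Request M)) : ℝ≥0∞ :=
  ⨅ C, optFrom s w C ρ

section opt

variable (s : Finset (Fin k)) (w : Fin k → ℝ≥0)

theorem optFrom_cons_le {C C' : Config M} {r : Request M} (h : SatisfiesOn s C' r)
    (ρ : List (Request M)) :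
    optFrom s w C (r :: ρ) ≤ moveCostOn s w C C' + optFrom s w C' ρ :=
  iInf₂_le C' h

/-- The first move from C can imitate a detour through C'; this is the triangle inequality. It makes
skipping a request harmless in `optFrom_mono`. -/
theorem optFrom_le_add (C C' : Config M) (ρ : List (Request M)) :
    optFrom s w C ρ ≤ moveCostOn s w C C' + optFrom s w C' ρ := by
  cases ρ with
  | nil => simp [optFrom]
  | cons r ρ =>
    conv_rhs => rw [optFrom]
    simp only [ENNReal.add_iInf]
    refine le_iInf₂ fun C'' h => (optFrom_cons_le s w h ρ).trans ?_
    rw [← add_assoc]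
    gcongr
    exact_mod_cast moveCostOn_triangle s w C C' C''

theorem optFrom_mono {ρ σ : List (Request M)} (h : ρ.Sublist σ) (C : Config M) :
    optFrom s w C ρ ≤ optFrom s w C σ := by
  induction h generalizing C with
  | slnil => rfl
  | cons r _ ih =>
    refine le_iInf₂ fun C' _ => (optFrom_le_add s w C C' _).trans ?_
    gcongr
    exact ih C'
  | cons_cons r _ ih =>
    refine le_iInf₂ fun C' h => (optFrom_cons_le s w h _).trans ?_
    gcongr
    exact ih C'

theorem optOn_mono {ρ σ : List (Request M)} (h : ρ.Sublist σ) : optOn s w ρ ≤ optOn s w σ :=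
  iInf_mono fun C => optFrom_mono s w h C

theorem optOn_le (C : Config M) (ρ : List (Request M)) : optOn s w ρ ≤ optFrom s w C ρ :=
  iInf_le _ C

theorem optOn_nil [Nonempty (Config M)] : optOn s w ([] : List (Request M)) = 0 := by
  simp [optOn, optFrom]

theorem optOn_empty_eq_top {ρ : List (Request M)} (h : ρ ≠ []) :
    optOn ∅ w ρ = ⊤ := by
  obtain ⟨r, ρ, rfl⟩ := List.exists_cons_of_ne_nil h
  simp [optOn, optFrom, SatisfiesOn]

/-- A trajectory that satisfies each request bounds the offline optimum. -/
theorem optFrom_le_sum (ρ : List (Request M)) (X : ℕ → Config M)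
    (hX : ∀ t r, ρ[t]? = some r → SatisfiesOn s (X (t + 1)) r) :
    optFrom s w (X 0) ρ ≤
      ((∑ t ∈ Finset.range ρ.length, moveCostOn s w (X t) (X (t + 1)) : ℝ≥0) : ℝ≥0∞) := by
  induction ρ generalizing X with
  | nil => simp [optFrom]
  | cons r ρ ih =>
    refine (optFrom_cons_le s w (hX 0 r (by simp)) ρ).trans ?_
    rw [List.length_cons, Finset.sum_range_succ', add_comm, ENNReal.coe_add]
    gcongr
    exact ih (fun t => X (t + 1)) fun t r' h => hX (t + 1) r' (by simpa using h)

/-- An offline solution for a sublist of the requests as a trajectory. -/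
theorem exists_trajectory_of_optFrom_lt (P : Request M → Bool) (ρ : List (Request M))
    (C : Config M) {W : ℝ≥0} (h : optFrom s w C (ρ.filter P) < W) :
    ∃ X : ℕ → Config M, X 0 = C ∧
      (∀ t r, ρ[t]? = some r → P r → SatisfiesOn s (X (t + 1)) r) ∧
      ∑ t ∈ Finset.range ρ.length, moveCostOn s w (X t) (X (t + 1)) < W := by
  induction ρ generalizing C W with
  | nil => exact ⟨fun _ => C, rfl, by simp, by simpa [optFrom] using h⟩
  | cons r ρ ih =>
    by_cases hr : P r
    · rw [List.filter_cons_of_pos hr, optFrom] at h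
      simp only [iInf_lt_iff] at h
      obtain ⟨C', hC', h⟩ := h
      have hle : moveCostOn s w C C' ≤ W := by
        exact_mod_cast (le_self_add.trans h.le)
      obtain ⟨D, rfl⟩ := exists_add_of_le hle
      rw [ENNReal.coe_add] at h
      obtain ⟨X, rfl, h1, h2⟩ := ih C' (lt_of_add_lt_add_left h)
      refine ⟨fun t => Nat.casesOn t C X, rfl, ?_, ?_⟩
      · rintro (_ | t) r' hr' hP
        · simp only [List.getElem?_cons_zero, Option.some.injEq] at hr'
          exact hr' ▸ hC'
        · exact h1 t r' (by simpa using hr') hP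
      · rw [List.length_cons, Finset.sum_range_succ', add_comm]
        exact add_lt_add_right h2 _
    · rw [List.filter_cons_of_neg hr] at h
      obtain ⟨X, rfl, h1, h2⟩ := ih C h
      refine ⟨fun t => Nat.casesOn t (X 0) X, rfl, ?_, ?_⟩
      · rintro (_ | t) r' hr' hP
        · simp only [List.getElem?_cons_zero, Option.some.injEq] at hr'
          exact absurd (hr' ▸ hP) hr
        · exact h1 t r' (by simpa using hr') hP
      · rw [List.length_cons, Finset.sum_range_succ']
        simpa [moveCostOn_self] using h2

end opt

theorem optFrom_univ_le_solutionCost (w : Fin k → ℝ≥0) (ρ : List (Request M))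
    (C : Fin (ρ.length + 1) → Config M) (hC : IsSolution ρ C) :
    optFrom Finset.univ w (C 0) ρ ≤ solutionCost w C := by
  induction ρ with
  | nil => simp [optFrom]
  | cons r ρ ih =>
    have h0 : SatisfiesOn Finset.univ (C 1) r := by
      obtain ⟨l, hl⟩ := hC 0
      exact ⟨l, Finset.mem_univ _, hl⟩
    refine (optFrom_cons_le _ w h0 ρ).trans ?_
    have h1 := ih (fun i => C i.succ) fun i => hC i.succ
    have h2 : solutionCost w C = moveCost w (C 0) (C 1) + solutionCost w fun i => C i.succ := by
      simp only [solutionCost]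
      exact Fin.sum_univ_succ _
    rw [h2, ENNReal.coe_add]
    gcongr
    · rfl
    · exact h1

theorem optOn_univ_le_OPT (w : Fin k → ℝ≥0) (ρ : List (Request M)) :
    optOn Finset.univ w ρ ≤ OPT w ρ :=
  le_iInf₂ fun C hC => (optOn_le _ w _ _).trans (optFrom_univ_le_solutionCost w ρ C hC)

/-! ### Combining many solutions into a single one -/

/-- The cost of the moves of a trajectory between the times `u` and `v`. -/
noncomputable def pathCost (s : Finset (Fin k)) (w : Fin k → ℝ≥0) (X : ℕ → Config M)
    (u v : ℕ) : ℝ :=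
  ∑ t ∈ Finset.Ico u v, (moveCostOn s w (X t) (X (t + 1)) : ℝ)

open scoped Classical in
/-- The number of moves of the server `a` between the times `u` and `v`. -/
noncomputable def moveCount (a : Fin k) (X : ℕ → Config M) (u v : ℕ) : ℕ :=
  ((Finset.Ico u v).filter fun t => X t a ≠ X (t + 1) a).card

/-- The reciprocal of the fraction of errors that a majority of solutions with `m` servers can
correct. -/
def errDen : ℕ → ℕ
  | 0 => 2
  | m + 1 => 8 * errDen m ^ 2

theorem two_le_errDen (m : ℕ) : 2 ≤ errDen m := by
  induction m with
  | zero => simp [errDen]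
  | succ m ih =>
    rw [errDen]
    nlinarith

theorem pathCost_nonneg (s : Finset (Fin k)) (w : Fin k → ℝ≥0) (X : ℕ → Config M) (u v : ℕ) :
    0 ≤ pathCost s w X u v :=
  Finset.sum_nonneg fun _ _ => NNReal.coe_nonneg _

theorem pathCost_add (s : Finset (Fin k)) (w : Fin k → ℝ≥0) (X : ℕ → Config M) {u v z : ℕ}
    (h : u ≤ v) (h' : v ≤ z) :
    pathCost s w X u z = pathCost s w X u v + pathCost s w X v z :=
  (Finset.sum_Ico_consecutive _ h h').symm

theorem pathCost_congr (s : Finset (Fin k)) (w : Fin k → ℝ≥0) {X Y : ℕ → Config M} {u v : ℕ}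
    (h : ∀ t, u ≤ t → t ≤ v → X t = Y t) : pathCost s w X u v = pathCost s w Y u v := by
  refine Finset.sum_congr rfl fun t ht => ?_
  rw [Finset.mem_Ico] at ht
  rw [h t ht.1 ht.2.le, h (t + 1) (by omega) ht.2]

theorem pathCost_insert {s : Finset (Fin k)} (w : Fin k → ℝ≥0) {a : Fin k} (ha : a ∉ s)
    (X : ℕ → Config M) (u v : ℕ) :
    pathCost (insert a s) w X u v = w a * moveCount a X u v + pathCost s w X u v := by
  classical
  unfold pathCost moveCount
  rw [Finset.card_filter, Nat.cast_sum, Finset.mul_sum, ← Finset.sum_add_distrib]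
  refine Finset.sum_congr rfl fun t _ => ?_
  rw [moveCostOn_insert s w ha, NNReal.coe_add]
  congr 1
  by_cases h : X t a = X (t + 1) a
  · simp [h, uniformDist_self]
  · simp [h, uniformDist_of_ne]

theorem pathCost_insert_update {s : Finset (Fin k)} (w : Fin k → ℝ≥0) {a : Fin k} (ha : a ∉ s)
    (X : ℕ → Config M) (p : M a) (u v : ℕ) :
    pathCost (insert a s) w (fun t => Function.update (X t) a p) u v = pathCost s w X u v := by
  refine Finset.sum_congr rfl fun t _ => ?_
  rw [moveCostOn_insert s w ha, moveCostOn_update s w ha]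
  simp [uniformDist_self]

theorem eq_of_moveCount_eq_zero {a : Fin k} {X : ℕ → Config M} {u v : ℕ}
    (h : moveCount a X u v = 0) {t : ℕ} (hu : u ≤ t) (hv : t ≤ v) : X t a = X u a := by
  induction t, hu using Nat.le_induction with
  | base => rfl
  | succ t hu ih =>
    rw [← ih (by omega)]
    by_contra hne
    classical
    have : t ∈ ((Finset.Ico u v).filter fun t => X t a ≠ X (t + 1) a) := by
      simp only [Finset.mem_filter, Finset.mem_Ico]
      exact ⟨⟨hu, hv⟩, fun h => hne h.symm⟩
    simp only [moveCount, Finset.card_eq_zero] at h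
    rw [h] at this
    simp at this

open scoped Classical in
/-- The solutions `X i`, `i ∈ I`, can be combined into a single one by the servers in `s`, as
long as each request is missed by few of them only. Here `D t` is the set of requests that have to
be served at time `t`. -/
def Combinable (M : Fin k → Type u) (s : Finset (Fin k)) (w : Fin k → ℝ≥0) : Prop :=
  ∀ (ι : Type u) (D : ℕ → Set (Request M)) (I : Finset ι) (X : ι → ℕ → Config M) (u v : ℕ),
    I.Nonempty → u ≤ v →
    (∀ t, u ≤ t → t ≤ v → ∀ r ∈ D t,
      errDen s.card * (I.filter fun i => ¬ SatisfiesOn s (X i t) r).card ≤ I.card) →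
    ∃ Y : ℕ → Config M, (∀ t, u ≤ t → t ≤ v → ∀ r ∈ D t, SatisfiesOn s (Y t) r) ∧
      I.card * pathCost s w Y u v ≤ 4 ^ s.card * ∑ i ∈ I, pathCost s w (X i) u v

/-- Without servers every solution misses every request, so `errDen 0 = 2` forces the sets of
requests to be empty. -/
theorem combinable_empty (w : Fin k → ℝ≥0) : Combinable M ∅ w := by
  classical
  intro ι D I X u v hI huv h
  obtain ⟨i, hi⟩ := hI
  refine ⟨X i, fun t hu hv r hr => ?_, by simp [pathCost, moveCostOn]⟩
  have h1 := h t hu hv r hr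
  have h2 : (I.filter fun i => ¬ SatisfiesOn ∅ (X i t) r) = I :=
    Finset.filter_true_of_mem fun i _ => by simp [SatisfiesOn]
  rw [h2] at h1
  have h3 : 0 < I.card := Finset.card_pos.2 ⟨i, hi⟩
  simp only [Finset.card_empty, errDen] at h1
  omega

/-- Among the classes of a finite set, one has at most the average value. -/
theorem exists_fiber_average_le {ι β : Type*} [DecidableEq β] (L : Finset ι) (hL : L.Nonempty)
    (g : ι → β) (c : ι → ℝ) :
    ∃ i ∈ L, L.card * ∑ j ∈ L with g j = g i, c j ≤
      (L.filter fun j => g j = g i).card * ∑ j ∈ L, c j := by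
  have key : ∑ b ∈ L.image g, (L.card : ℝ) * ∑ j ∈ L with g j = b, c j ≤
      ∑ b ∈ L.image g, ((L.filter fun j => g j = b).card : ℝ) * ∑ j ∈ L, c j := by
    rw [← Finset.mul_sum, ← Finset.sum_mul,
      Finset.sum_fiberwise_of_maps_to fun j hj => Finset.mem_image_of_mem g hj, ← Nat.cast_sum,
      ← Finset.card_eq_sum_card_fiberwise fun j hj => Finset.mem_image_of_mem g hj]
  obtain ⟨b, hb, h⟩ := Finset.exists_le_of_sum_le (hL.image g) key
  obtain ⟨i, hi, rfl⟩ := Finset.mem_image.1 hb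
  exact ⟨i, hi, h⟩

open scoped Classical in
/-- Combining solutions whose server `a` rarely moves. -/
theorem Combinable.of_few_moves {s : Finset (Fin k)} {w : Fin k → ℝ≥0} {a : Fin k} (ha : a ∉ s)
    (H : Combinable M s w) {ι : Type u} (D : ℕ → Set (Request M)) (I : Finset ι)
    (X : ι → ℕ → Config M) (u v : ℕ) (hI : I.Nonempty) (huv : u ≤ v)
    (h : ∀ t, u ≤ t → t ≤ v → ∀ r ∈ D t, errDen (s.card + 1) *
      (I.filter fun i => ¬ SatisfiesOn (insert a s) (X i t) r).card ≤ I.card)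
    (hmove : 4 * ∑ i ∈ I, moveCount a (X i) u v ≤ I.card) :
    ∃ Y : ℕ → Config M, (∀ t, u ≤ t → t ≤ v → ∀ r ∈ D t, SatisfiesOn (insert a s) (Y t) r) ∧
      3 * I.card * pathCost (insert a s) w Y u v ≤
        8 * 4 ^ s.card * ∑ i ∈ I, pathCost s w (X i) u v := by
  set e := errDen s.card with he
  have he2 : 2 ≤ e := two_le_errDen _
  have hE : errDen (s.card + 1) = 8 * e ^ 2 := rfl
  rw [hE] at h
  have hIpos : 0 < I.card := hI.card_pos
  -- At least three quarters of the solutions never move a, so each of these is described by one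
  -- position of a.
  set J := I.filter fun i => moveCount a (X i) u v = 0 with hJ
  have hJI : J ⊆ I := Finset.filter_subset _ _
  have hJcard : 3 * I.card ≤ 4 * J.card := by
    have h1 : (I.filter fun i => ¬ moveCount a (X i) u v = 0).card ≤
        ∑ i ∈ I, moveCount a (X i) u v := by
      rw [Finset.card_filter]
      refine Finset.sum_le_sum fun i _ => ?_
      split_ifs <;> omega
    have h2 := Finset.card_filter_add_card_filter_not (s := I) (fun i => moveCount a (X i) u v = 0)
    rw [← hJ] at h2
    omega
  have hconst : ∀ i ∈ J, ∀ t, u ≤ t → t ≤ v → X i t a = X i u a := fun i hi t hu hv =>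
    eq_of_moveCount_eq_zero (Finset.mem_filter.1 hi).2 hu hv
  have hmiss : ∀ t, u ≤ t → t ≤ v → ∀ r ∈ D t,
      6 * e ^ 2 * (I.filter fun i => ¬ SatisfiesOn (insert a s) (X i t) r).card ≤ J.card := by
    intro t hu hv r hr
    have := h t hu hv r hr
    nlinarith
  have hcost : ∀ L ⊆ I, ∑ i ∈ L, pathCost s w (X i) u v ≤ ∑ i ∈ I, pathCost s w (X i) u v :=
    fun L hL => Finset.sum_le_sum_of_subset_of_nonneg hL fun _ _ _ => pathCost_nonneg _ _ _ _ _
  -- Solutions in J are grouped by the position of a; L collects those in large groups, of size at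
  -- least |J| / (4e).
  set G : ι → Finset ι := fun i => J.filter fun j => X j u a = X i u a with hG
  set L := J.filter fun i => J.card ≤ 4 * e * (G i).card with hL
  have hLJ : L ⊆ J := Finset.filter_subset _ _
  by_cases hcase : J.card ≤ 2 * L.card
  · have hLne : L.Nonempty := Finset.card_pos.1 (by omega)
    obtain ⟨i, hi, havg⟩ := exists_fiber_average_le L hLne (fun j => X j u a)
      fun j => pathCost s w (X j) u v
    have hGi : (L.filter fun j => X j u a = X i u a) = G i := by
      ext j
      simp only [hL, hG, Finset.mem_filter]
      refine ⟨fun hj => ⟨hj.1.1, hj.2⟩, fun hj => ⟨⟨hj.1, ?_⟩, hj.2⟩⟩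
      rw [hj.2]
      exact (Finset.mem_filter.1 hi).2
    rw [hGi] at havg
    have hiL : J.card ≤ 4 * e * (G i).card := (Finset.mem_filter.1 hi).2
    have hGJ : G i ⊆ J := Finset.filter_subset _ _
    have hGne : (G i).Nonempty := ⟨i, Finset.mem_filter.2 ⟨hLJ hi, rfl⟩⟩
    -- Large groups prevail: a is fixed at the position of a group of at most average cost. Only
    -- requests elsewhere are left to `s`, and the group is large enough that at most a 1/e fraction
    -- of it misses any of them.
    obtain ⟨Y, hY, hYc⟩ := H ι (fun t => {r ∈ D t | r a ≠ X i u a}) (G i) X u v hGne huv (by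
      intro t hu hv r hr
      have h1 := hmiss t hu hv r hr.1
      have h2 : ((G i).filter fun j => ¬ SatisfiesOn s (X j t) r).card ≤
          (I.filter fun i => ¬ SatisfiesOn (insert a s) (X i t) r).card := by
        refine Finset.card_le_card fun j hj => ?_
        rw [Finset.mem_filter] at hj ⊢
        refine ⟨hJI (hGJ hj.1), ?_⟩
        rw [satisfiesOn_insert, not_or]
        refine ⟨?_, hj.2⟩
        rw [hconst j (hGJ hj.1) t hu hv, (Finset.mem_filter.1 hj.1).2]
        exact fun h => hr.2 h.symm
      have h3 : 4 * e * (e * ((G i).filter fun j => ¬ SatisfiesOn s (X j t) r).card) ≤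
          4 * e * (G i).card := by nlinarith
      exact Nat.le_of_mul_le_mul_left h3 (by omega))
    refine ⟨fun t => Function.update (Y t) a (X i u a), fun t hu hv r hr => ?_, ?_⟩
    · rw [satisfiesOn_insert, SatisfiesOn.update_iff ha]
      by_cases hra : r a = X i u a
      · left
        simp [hra]
      · exact Or.inr (hY t hu hv r ⟨hr, hra⟩)
    · rw [pathCost_insert_update w ha]
      have hGpos : (0 : ℝ) < (G i).card := by exact_mod_cast hGne.card_pos
      have hLc := hcost L (hLJ.trans hJI)
      have h38 : (3 * I.card : ℝ) ≤ 8 * L.card := by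
        exact_mod_cast (by omega : 3 * I.card ≤ 8 * L.card)
      have hY0 := pathCost_nonneg s w Y u v
      have h5 : (G i).card * (L.card * pathCost s w Y u v) ≤
          (G i).card * (4 ^ s.card * ∑ i ∈ I, pathCost s w (X i) u v) := by
        calc (G i).card * (L.card * pathCost s w Y u v)
            = L.card * ((G i).card * pathCost s w Y u v) := by ring
          _ ≤ L.card * (4 ^ s.card * ∑ i ∈ G i, pathCost s w (X i) u v) := by gcongr
          _ = 4 ^ s.card * (L.card * ∑ i ∈ G i, pathCost s w (X i) u v) := by ring
          _ ≤ 4 ^ s.card * ((G i).card * ∑ i ∈ L, pathCost s w (X i) u v) := by gcongr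
          _ ≤ 4 ^ s.card * ((G i).card * ∑ i ∈ I, pathCost s w (X i) u v) := by gcongr
          _ = _ := by ring
      have h6 := le_of_mul_le_mul_left h5 hGpos
      nlinarith [mul_le_mul_of_nonneg_right h38 hY0]
  -- Small groups prevail: a given request is covered by a in only one small group, so a can be
  -- ignored altogether.
  · set K := J \ L with hK
    have hKJ : K ⊆ J := Finset.sdiff_subset
    have hKcard : K.card + L.card = J.card := Finset.card_sdiff_add_card_eq_card hLJ
    have hKne : K.Nonempty := Finset.card_pos.1 (by omega)
    obtain ⟨Y, hY, hYc⟩ := H ι D K X u v hKne huv (by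
      intro t hu hv r hr
      have h1 := hmiss t hu hv r hr
      set B := K.filter fun j => X j u a = r a with hB
      have hBc : 4 * e * B.card ≤ J.card := by
        rcases B.eq_empty_or_nonempty with h0 | ⟨j, hj⟩
        · simp [h0]
        · have hj' := Finset.mem_filter.1 hj
          have hjL := Finset.mem_sdiff.1 hj'.1
          have h3 : ¬ J.card ≤ 4 * e * (G j).card := fun h =>
            hjL.2 (Finset.mem_filter.2 ⟨hjL.1, h⟩)
          rw [not_le] at h3
          have h4 : B ⊆ G j := by
            intro i hi
            rw [hB, Finset.mem_filter] at hi
            exact Finset.mem_filter.2 ⟨hKJ hi.1, hi.2.trans hj'.2.symm⟩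
          have h5 := Finset.card_le_card h4
          nlinarith
      have h2 : (K.filter fun j => ¬ SatisfiesOn s (X j t) r).card ≤
          (I.filter fun i => ¬ SatisfiesOn (insert a s) (X i t) r).card + B.card := by
        refine (Finset.card_le_card fun j hj => ?_).trans (Finset.card_union_le _ _)
        rw [Finset.mem_filter] at hj
        rw [Finset.mem_union, Finset.mem_filter, Finset.mem_filter, satisfiesOn_insert,
          hconst j (hKJ hj.1) t hu hv]
        have := hJI (hKJ hj.1)
        tauto
      -- Since e ≥ 2, the original misses contribute at most |J| / 12 and the group at r a at most
      -- |J| / 4, in total less than |J| / 2 < |K|.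
      have h6 : 12 * (e * (I.filter fun i => ¬ SatisfiesOn (insert a s) (X i t) r).card) ≤
          J.card := by nlinarith
      have h7 : e * (K.filter fun j => ¬ SatisfiesOn s (X j t) r).card ≤
          e * (I.filter fun i => ¬ SatisfiesOn (insert a s) (X i t) r).card + e * B.card := by
        rw [← mul_add]
        gcongr
      have h8 : 4 * (e * B.card) ≤ J.card := by linarith
      change e * _ ≤ _
      omega)
    obtain ⟨i, hi⟩ := hI
    -- Any position would do; it only has to be constant in time.
    refine ⟨fun t => Function.update (Y t) a (X i u a), fun t hu hv r hr => ?_, ?_⟩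
    · rw [satisfiesOn_insert, SatisfiesOn.update_iff ha]
      exact Or.inr (hY t hu hv r hr)
    · rw [pathCost_insert_update w ha]
      have hKc := hcost K (hKJ.trans hJI)
      have h38 : (3 * I.card : ℝ) ≤ 8 * K.card := by
        exact_mod_cast (by omega : 3 * I.card ≤ 8 * K.card)
      have hY0 := pathCost_nonneg s w Y u v
      have h5 : (4 : ℝ) ^ s.card * ∑ i ∈ K, pathCost s w (X i) u v ≤
        4 ^ s.card * ∑ i ∈ I, pathCost s w (X i) u v := by gcongr
      nlinarith [mul_le_mul_of_nonneg_right h38 hY0]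

/-- Time is cut greedily whenever the family has moved a more than |I| / 4 times. Inside a piece
`Combinable.of_few_moves` applies and loses 8/3 ≤ 4. At a cut the combined solution may move every
server; as a is the heaviest, the moves of a in the piece pay for this. -/
theorem Combinable.insert_max {s : Finset (Fin k)} {w : Fin k → ℝ≥0} {a : Fin k} (ha : a ∉ s)
    (hw : ∀ l ∈ s, w l ≤ w a) (H : Combinable M s w) : Combinable M (insert a s) w := by
  classical
  intro ι D I X u v hI huv h
  have hcard : (insert a s).card = s.card + 1 := Finset.card_insert_of_notMem ha
  rw [hcard] at h ⊢
  induction hn : v - u using Nat.strong_induction_on generalizing u with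
  | _ n ih =>
  subst hn
  have hs0 : ∀ u v, 0 ≤ ∑ i ∈ I, pathCost s w (X i) u v := fun u v =>
    Finset.sum_nonneg fun _ _ => pathCost_nonneg _ _ _ _ _
  have hins : ∀ u v, ∑ i ∈ I, pathCost (insert a s) w (X i) u v =
      w a * ∑ i ∈ I, (moveCount a (X i) u v : ℝ) + ∑ i ∈ I, pathCost s w (X i) u v := by
    intro u v
    rw [Finset.mul_sum, ← Finset.sum_add_distrib]
    exact Finset.sum_congr rfl fun i _ => pathCost_insert w ha _ _ _
  by_cases hmove : 4 * ∑ i ∈ I, moveCount a (X i) u v ≤ I.card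
  · obtain ⟨Y, hY, hYc⟩ := H.of_few_moves ha D I X u v hI huv h hmove
    refine ⟨Y, hY, ?_⟩
    have h0 : (0 : ℝ) ≤ w a * ∑ i ∈ I, (moveCount a (X i) u v : ℝ) := by positivity
    rw [hins]
    have h4 : (0 : ℝ) < 4 ^ s.card := by positivity
    have := hs0 u v
    rw [pow_succ]
    nlinarith [mul_nonneg h4.le h0, mul_nonneg h4.le this]
  · have hex : ∃ n, ¬ 4 * ∑ i ∈ I, moveCount a (X i) u n ≤ I.card := ⟨v, hmove⟩
    obtain ⟨z, hz, hmin⟩ : ∃ z, (¬ 4 * ∑ i ∈ I, moveCount a (X i) u z ≤ I.card) ∧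
        ∀ n < z, 4 * ∑ i ∈ I, moveCount a (X i) u n ≤ I.card :=
      ⟨Nat.find hex, Nat.find_spec hex, fun n hn => not_not.1 (Nat.find_min hex hn)⟩
    have huz : u < z := by
      by_contra hle
      apply hz
      have : ∀ i, moveCount a (X i) u z = 0 := fun i => by
        simp [moveCount, Finset.Ico_eq_empty_of_le (not_lt.1 hle)]
      simp [this]
    have hzv : z ≤ v := by
      by_contra hlt
      exact hmove (hmin v (not_le.1 hlt))
    -- The step from y to y + 1 exceeds the quota: the piece ends at y, and this step is the jump
    -- between the two combined solutions.
    obtain ⟨y, rfl⟩ : ∃ y, z = y + 1 := ⟨z - 1, by omega⟩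
    obtain ⟨Y₁, hY₁, hc₁⟩ := H.of_few_moves ha D I X u y hI (by omega)
      (fun t hu hv => h t hu (by omega)) (hmin y (by omega))
    obtain ⟨Y₂, hY₂, hc₂⟩ := ih (v - (y + 1)) (by omega) (y + 1) hzv
      (fun t hu hv => h t (by omega) hv) rfl
    refine ⟨fun t => if t ≤ y then Y₁ t else Y₂ t, fun t hu hv r hr => ?_, ?_⟩
    · dsimp only
      split_ifs with hty
      · exact hY₁ t hu hty r hr
      · exact hY₂ t (by omega) hv r hr
    · rw [pathCost_add _ _ _ huz.le hzv, pathCost_add _ _ _ (by omega : u ≤ y) y.le_succ]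
      rw [pathCost_congr (Y := Y₁) _ _ (fun t _ ht => if_pos ht),
        pathCost_congr (u := y + 1) (Y := Y₂) _ _ (fun t ht _ => if_neg (by omega))]
      have hjump : ∀ Y : ℕ → Config M,
          pathCost (insert a s) w Y y (y + 1) ≤ (s.card + 1 : ℝ) * w a := by
        intro Y
        simp only [pathCost, Nat.Ico_succ_singleton, Finset.sum_singleton]
        have := moveCostOn_le_card_mul (insert a s) w (W := w a) (by
          intro l hl
          rcases Finset.mem_insert.1 hl with rfl | hl
          · rfl
          · exact hw l hl) (Y y) (Y (y + 1))
        rw [hcard] at this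
        exact_mod_cast this
      have hj := hjump fun t => if t ≤ y then Y₁ t else Y₂ t
      have hj0 := pathCost_nonneg (insert a s) w (fun t => if t ≤ y then Y₁ t else Y₂ t) y (y + 1)
      have hsplit : ∑ i ∈ I, pathCost (insert a s) w (X i) u v =
          ∑ i ∈ I, pathCost (insert a s) w (X i) u (y + 1) +
          ∑ i ∈ I, pathCost (insert a s) w (X i) (y + 1) v := by
        rw [← Finset.sum_add_distrib]
        exact Finset.sum_congr rfl fun i _ => pathCost_add _ _ _ huz.le hzv
      have hsplit' : ∑ i ∈ I, pathCost s w (X i) u y ≤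
          ∑ i ∈ I, pathCost s w (X i) u (y + 1) := by
        refine Finset.sum_le_sum fun i _ => ?_
        rw [pathCost_add _ _ _ (by omega : u ≤ y) y.le_succ]
        exact le_add_of_nonneg_right (pathCost_nonneg _ _ _ _ _)
      rw [hsplit, hins u (y + 1)]
      have hzR : (I.card : ℝ) ≤ 4 * ∑ i ∈ I, (moveCount a (X i) u (y + 1) : ℝ) := by
        exact_mod_cast (not_le.1 hz).le
      have hpow : (s.card + 1 : ℝ) ≤ 4 ^ s.card := by
        exact_mod_cast (Nat.lt_pow_self (by norm_num : 1 < 4) : s.card < 4 ^ s.card)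
      set jmp := pathCost (insert a s) w (fun t => if t ≤ y then Y₁ t else Y₂ t) y (y + 1)
      set mv := ∑ i ∈ I, (moveCount a (X i) u (y + 1) : ℝ)
      set P := (4 : ℝ) ^ s.card
      have hwa : (0 : ℝ) ≤ w a := NNReal.coe_nonneg _
      have h1 : I.card * jmp ≤ 4 * P * (w a * mv) := by
        calc (I.card : ℝ) * jmp ≤ (4 * mv) * ((s.card + 1) * w a) := by gcongr
          _ ≤ (4 * mv) * (P * w a) := by gcongr
          _ = _ := by ring
      have hP : 0 < P := by positivity
      have h2 : P * ∑ i ∈ I, pathCost s w (X i) u y ≤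
        P * ∑ i ∈ I, pathCost s w (X i) u (y + 1) := by gcongr
      have h3 := mul_nonneg hP.le (hs0 u y)
      rw [pow_succ] at hc₂ ⊢
      change _ ≤ P * 4 * (_ + _)
      change _ ≤ P * 4 * _ at hc₂
      nlinarith

theorem combinable {w : Fin k → ℝ≥0} (s : Finset (Fin k)) : Combinable M s w := by
  induction s using Finset.induction_on_max_value w with
  | empty => exact combinable_empty w
  | insert a s ha hw ih => exact ih.insert_max ha hw

/-! ### Candidates for the heaviest server -/

/-- A candidate for the position of the server `a` in a phase. With `Sum.inl q` the server rests
at `q` without being used to serve requests, with `Sum.inr p` it serves the requests at `p`. -/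
abbrev Candidate (M : Fin k → Type u) (a : Fin k) : Type u := M a ⊕ M a

/-- The position of the server `a`. -/
def Candidate.pos {a : Fin k} : Candidate M a → M a := Sum.elim id id

open scoped Classical in
/-- The requests that are left to the other servers. -/
noncomputable def Candidate.isPending {a : Fin k} : Candidate M a → Request M → Bool
  | Sum.inl _, _ => true
  | Sum.inr p, r => decide (r a ≠ p)

/-- The offline cost of the servers in `s` up to which the generic candidate is kept. -/
noncomputable def threshold (s : Finset (Fin k)) (w : Fin k → ℝ≥0) (a : Fin k) : ℝ≥0 :=
  4 ^ s.card * w a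

/-- A candidate is alive as long as the pending requests of the phase are cheap for the
servers in `s`. -/
def Candidate.IsAlive (s : Finset (Fin k)) (w : Fin k → ℝ≥0) {a : Fin k} (h : List (Request M)) :
    Candidate M a → Prop
  | Sum.inl _ => optOn s w h ≤ threshold s w a
  | Sum.inr p => optOn s w (h.filter (Candidate.isPending (Sum.inr p : Candidate M a))) < w a

/-- The positions that are alive after the requests `h` of the phase. -/
def alivePositions (s : Finset (Fin k)) (w : Fin k → ℝ≥0) (a : Fin k) (h : List (Request M)) :
    Set (M a) :=
  {p | Candidate.IsAlive s w h (Sum.inr p : Candidate M a)}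

section alive

variable (s : Finset (Fin k)) (w : Fin k → ℝ≥0) {a : Fin k}

theorem le_threshold : w a ≤ threshold s w a :=
  le_mul_of_one_le_left' (one_le_pow₀ (by norm_num))

theorem Candidate.IsAlive.optOn_filter_le {g : Candidate M a} {h : List (Request M)}
    (hg : g.IsAlive s w h) : optOn s w (h.filter g.isPending) ≤ threshold s w a := by
  cases g with
  | inl q =>
    have : h.filter (Candidate.isPending (Sum.inl q : Candidate M a)) = h :=
      List.filter_eq_self.2 fun _ _ => rfl
    rw [this]
    exact hg
  | inr p => exact hg.le.trans (by exact_mod_cast le_threshold s w)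

theorem Candidate.IsAlive.of_append {g : Candidate M a} {h σ : List (Request M)}
    (hg : g.IsAlive s w (h ++ σ)) : g.IsAlive s w h := by
  cases g with
  | inl q => exact (optOn_mono s w (List.sublist_append_left h σ)).trans hg
  | inr p => exact (optOn_mono s w ((List.sublist_append_left h σ).filter _)).trans_lt hg

/-- Each alive p comes with a trajectory of `s` of cost below w_a that misses only requests with r a
= p. Hence a request is missed by at most one trajectory, and `errDen s.card` of them would combine
into a solution of cost at most the threshold. -/
theorem card_lt_errDen {h : List (Request M)} (hh : threshold s w a < optOn s w h)
    (I : Finset (M a)) (hI : ∀ p ∈ I, p ∈ alivePositions s w a h) : I.card < errDen s.card := by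
  classical
  by_contra! hcard
  have hex : ∀ p ∈ I, ∃ X : ℕ → Config M,
      (∀ t r, h[t]? = some r → r a ≠ p → SatisfiesOn s (X (t + 1)) r) ∧
      ∑ t ∈ Finset.range h.length, moveCostOn s w (X t) (X (t + 1)) < w a := by
    intro p hp
    obtain ⟨C, hC⟩ := iInf_lt_iff.1 (show optOn s w _ < w a from hI p hp)
    obtain ⟨X, _, hX, hXc⟩ := exists_trajectory_of_optFrom_lt s w _ h C hC
    exact ⟨X, fun t r htr hr => hX t r htr (by simpa [Candidate.isPending] using hr), hXc⟩
  have hIne : I.Nonempty := Finset.card_pos.1 (by have := two_le_errDen s.card; omega)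
  have : Nonempty (Config M) := by
    obtain ⟨p, hp⟩ := hIne
    obtain ⟨X, -⟩ := hex p hp
    exact ⟨X 0⟩
  choose! X hX hXc using hex
  obtain ⟨Y, hY, hYc⟩ := combinable (M := M) (w := w) s (M a)
    -- Time 0 is the initial configuration, so request j is due at time j + 1 and nothing is due at
    -- time 0.
    (fun t => {r | ∃ j, t = j + 1 ∧ h[j]? = some r}) I X 0 h.length hIne (Nat.zero_le _) (by
      rintro t - - r ⟨j, rfl, hj⟩
      have h1 : (I.filter fun p => ¬ SatisfiesOn s (X p (j + 1)) r).card ≤ 1 := by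
        refine Finset.card_le_one.2 fun p hp q hq => ?_
        rw [Finset.mem_filter] at hp hq
        have h2 : ∀ p ∈ I, ¬ SatisfiesOn s (X p (j + 1)) r → r a = p := fun p hp hn =>
          not_not.1 fun hne => hn (hX p hp j r hj hne)
        exact (h2 p hp.1 hp.2).symm.trans (h2 q hq.1 hq.2)
      calc _ ≤ errDen s.card * 1 := by gcongr
        _ ≤ _ := by omega)
  have hYopt := optFrom_le_sum s w h Y fun t r htr => by
    have hlt : t < h.length := (List.getElem?_eq_some_iff.1 htr).1
    exact hY (t + 1) (Nat.zero_le _) hlt r ⟨t, rfl, htr⟩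
  have hle : ∑ t ∈ Finset.range h.length, moveCostOn s w (Y t) (Y (t + 1)) ≤
      threshold s w a := by
    have hpc : ∀ Z : ℕ → Config M, pathCost s w Z 0 h.length =
        ((∑ t ∈ Finset.range h.length, moveCostOn s w (Z t) (Z (t + 1)) : ℝ≥0) : ℝ) := by
      intro Z
      rw [pathCost, ← Finset.range_eq_Ico, NNReal.coe_sum]
    rw [hpc] at hYc
    have hsum : ∑ p ∈ I, pathCost s w (X p) 0 h.length ≤ I.card * (w a : ℝ) := by
      rw [← nsmul_eq_mul]
      refine Finset.sum_le_card_nsmul _ _ _ fun p hp => ?_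
      rw [hpc]
      exact_mod_cast (hXc p hp).le
    have hpos : (0 : ℝ) < I.card := by exact_mod_cast hIne.card_pos
    have h3 := hYc.trans (mul_le_mul_of_nonneg_left hsum (by positivity : (0:ℝ) ≤ 4 ^ s.card))
    rw [mul_left_comm] at h3
    have h4 := le_of_mul_le_mul_left h3 hpos
    rw [← NNReal.coe_le_coe]
    simpa [threshold] using h4
  exact absurd (((optOn_le s w (Y 0) h).trans hYopt).trans (ENNReal.coe_le_coe.2 hle)) hh.not_ge

theorem finite_alivePositions {h : List (Request M)} (hh : threshold s w a < optOn s w h) :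
    (alivePositions s w a h).Finite := by
  by_contra hinf
  obtain ⟨I, hI, hcard⟩ := Set.Infinite.exists_subset_card_eq hinf (errDen s.card)
  exact (card_lt_errDen s w hh I fun p hp => hI hp).ne hcard

end alive

/-! ### Randomized algorithms for a subset of the servers, and their extension by one server -/

/-- A randomized online algorithm that serves requests with the servers in `s` and may be started
in any configuration. -/
structure PartialAlgorithm (M : Fin k → Type u) (s : Finset (Fin k)) where
  /-- the states of the memory -/
  Memory : Type u
  /-- the positions of the servers -/
  config : Memory → Config M
  /-- the initial memory for a given initial configuration -/
  start : Config M → Memory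
  /-- the random reaction to a request -/
  next : Memory → Request M → PMF Memory
  config_start : ∀ C, config (start C) = C
  satisfies_next : s.Nonempty → ∀ m r, ∀ m' ∈ (next m r).support, SatisfiesOn s (config m') r

/-- The expected cost of the servers in `s`. -/
noncomputable def PartialAlgorithm.costFrom {s : Finset (Fin k)} (A : PartialAlgorithm M s)
    (w : Fin k → ℝ≥0) : A.Memory → List (Request M) → ℝ≥0∞
  | _, [] => 0
  | m, r :: ρ => ∑' m', A.next m r m' *
      ((moveCostOn s w (A.config m) (A.config m') : ℝ≥0∞) + costFrom A w m' ρ)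

theorem tsum_pure_mul {α : Type*} (x : α) (f : α → ℝ≥0∞) :
    ∑' y, PMF.pure x y * f y = f x := by
  classical
  simp [PMF.pure_apply]

theorem tsum_map_mul {α β : Type*} (p : PMF α) (g : α → β) (f : β → ℝ≥0∞) :
    ∑' y, p.map g y * f y = ∑' x, p x * f (g x) := by
  classical
  simp only [PMF.map_apply, ← ENNReal.tsum_mul_right]
  rw [ENNReal.tsum_comm]
  refine tsum_congr fun x => ?_
  rw [tsum_eq_single (g x)]
  · simp
  · intro y hy
    simp [hy]

theorem tsum_uniformOfFinset_mul {α : Type*} (I : Finset α) (hI : I.Nonempty) (f : α → ℝ≥0∞) :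
    ∑' x, PMF.uniformOfFinset I hI x * f x = (∑ x ∈ I, f x) / I.card := by
  classical
  rw [tsum_eq_sum (s := I) fun x hx => by simp [PMF.uniformOfFinset_apply_of_notMem hI hx],
    div_eq_mul_inv, Finset.sum_mul]
  refine Finset.sum_congr rfl fun x hx => ?_
  rw [PMF.uniformOfFinset_apply_of_mem hI hx, mul_comm]

section compose

variable {s : Finset (Fin k)} (w : Fin k → ℝ≥0) {a : Fin k}

/-- The memory of the composed algorithm: the requests of the current phase, the current candidate
for the server `a`, and the memory of the algorithm for the other servers. -/
structure PhaseMemory (A : PartialAlgorithm M s) (a : Fin k) : Type u where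
  /-- the requests of the current phase -/
  history : List (Request M)
  /-- the current candidate -/
  cand : Candidate M a
  /-- the memory of the algorithm for the other servers -/
  sub : A.Memory

open scoped Classical in
/-- The reaction of the composed algorithm to a request. -/
noncomputable def PhaseMemory.next {A : PartialAlgorithm M s} (x : PhaseMemory A a)
    (r : Request M) : PMF (PhaseMemory A a) :=
  if x.cand.IsAlive s w (x.history ++ [r]) then
    if x.cand.isPending r then
      (A.next x.sub r).map fun m => ⟨x.history ++ [r], x.cand, m⟩
    else PMF.pure ⟨x.history ++ [r], x.cand, x.sub⟩
  else if hP : (alivePositions s w a (x.history ++ [r])).Finite ∧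
      (alivePositions s w a (x.history ++ [r])).Nonempty then
    -- The other servers jump to r itself, which serves r as soon as `s` is nonempty.
    (PMF.uniformOfFinset hP.1.toFinset (hP.1.toFinset_nonempty.2 hP.2)).map
      fun p => ⟨x.history ++ [r], Sum.inr p, A.start r⟩
  -- The request that kills the last candidate closes the old phase; moving to r serves it, and the
  -- next phase starts with an empty history.
  else PMF.pure ⟨[], Sum.inl (r a), A.start r⟩

/-- The positions of the servers of the composed algorithm. -/
def PhaseMemory.config {A : PartialAlgorithm M s} (x : PhaseMemory A a) : Config M :=
  Function.update (A.config x.sub) a x.cand.pos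

/-- With no other servers a pending request has infinite cost, so an alive candidate leaves nothing
pending. This is why the base case needs no separate algorithm for one server. -/
theorem Candidate.not_isPending_of_isAlive_empty {g : Candidate M a} {h : List (Request M)}
    {r : Request M} (hg : g.IsAlive ∅ w (h ++ [r])) : ¬ g.isPending r := by
  intro hr
  have h1 := hg.optOn_filter_le
  rw [optOn_empty_eq_top w (List.ne_nil_of_mem (a := r) (by simp [hr]))] at h1
  simp at h1

theorem Candidate.eq_pos_of_not_isPending {g : Candidate M a} {r : Request M}
    (h : ¬ g.isPending r) : r a = g.pos := by
  cases g with
  | inl q => simp [Candidate.isPending] at h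
  | inr p => simpa [Candidate.isPending, Candidate.pos] using h

theorem PhaseMemory.satisfies_next {A : PartialAlgorithm M s} (ha : a ∉ s) (x : PhaseMemory A a)
    (r : Request M) (y : PhaseMemory A a) (hy : y ∈ (x.next w r).support) :
    SatisfiesOn (insert a s) y.config r := by
  rw [satisfiesOn_insert, PhaseMemory.config, SatisfiesOn.update_iff ha, Function.update_self]
  unfold PhaseMemory.next at hy
  split_ifs at hy with h1 h2 h3
  · obtain ⟨m, hm, rfl⟩ := (PMF.mem_support_map_iff _ _ _).1 hy
    rcases s.eq_empty_or_nonempty with rfl | hs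
    · exact absurd h2 (Candidate.not_isPending_of_isAlive_empty w h1)
    · exact Or.inr (A.satisfies_next hs _ _ _ hm)
  · rw [PMF.mem_support_pure_iff] at hy
    subst hy
    exact Or.inl (Candidate.eq_pos_of_not_isPending h2).symm
  · obtain ⟨p, hp, rfl⟩ := (PMF.mem_support_map_iff _ _ _).1 hy
    rw [PMF.mem_support_uniformOfFinset_iff, Set.Finite.mem_toFinset] at hp
    rcases s.eq_empty_or_nonempty with rfl | ⟨l, hl⟩
    · exact Or.inl (Candidate.eq_pos_of_not_isPending
        (Candidate.not_isPending_of_isAlive_empty w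
          (show Candidate.IsAlive ∅ w (x.history ++ [r]) (Sum.inr p) from hp))).symm
    · exact Or.inr ⟨l, hl, by simp [A.config_start]⟩
  · rw [PMF.mem_support_pure_iff] at hy
    subst hy
    exact Or.inl rfl

/-- Given an algorithm for the servers in `s`, the algorithm that in addition uses the server `a`:
in a phase it leaves this server alone as long as the other servers can serve the requests at a
moderate cost, and then moves it to random positions that are still alive. -/
noncomputable def PartialAlgorithm.compose (A : PartialAlgorithm M s) (ha : a ∉ s) :
    PartialAlgorithm M (insert a s) where
  Memory := PhaseMemory A a
  config := PhaseMemory.config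
  start C := ⟨[], Sum.inl (C a), A.start C⟩
  next x r := x.next w r
  config_start C := by simp [PhaseMemory.config, A.config_start, Candidate.pos]
  satisfies_next _ := PhaseMemory.satisfies_next w ha

variable (s)

open scoped Classical in
/-- The requests that are served by the other servers as long as the candidate is alive. -/
noncomputable def Candidate.pendingWhileAlive :
    List (Request M) → Candidate M a → List (Request M) → List (Request M)
  | _, _, [] => []
  | h, g, r :: ρ =>
    if g.IsAlive s w (h ++ [r]) then
      if g.isPending r then r :: pendingWhileAlive (h ++ [r]) g ρ
      else pendingWhileAlive (h ++ [r]) g ρ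
    else []

open scoped Classical in
/-- The expected number of candidates after the first one, multiplied by `D`. -/
noncomputable def Candidate.changeCost (D : ℝ≥0) :
    List (Request M) → Candidate M a → List (Request M) → ℝ≥0
  | _, _, [] => 0
  | h, g, r :: ρ =>
    if g.IsAlive s w (h ++ [r]) then changeCost D (h ++ [r]) g ρ
    else if hP : (alivePositions s w a (h ++ [r])).Finite ∧
        (alivePositions s w a (h ++ [r])).Nonempty then
      D + (∑ p ∈ hP.1.toFinset, changeCost D (h ++ [r]) (Sum.inr p) ρ) / hP.1.toFinset.card
    else D + changeCost D [] (Sum.inl (r a)) ρ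

theorem Candidate.IsAlive.optOn_pendingWhileAlive_le {g : Candidate M a} {h : List (Request M)}
    (hg : g.IsAlive s w h) (ρ : List (Request M)) :
    optOn s w (g.pendingWhileAlive s w h ρ) ≤ threshold s w a := by
  -- The pending part of the history is included so that the bound can be read off from aliveness at
  -- the last moment.
  suffices H : optOn s w (h.filter g.isPending ++ g.pendingWhileAlive s w h ρ) ≤
      threshold s w a from (optOn_mono s w (List.sublist_append_right _ _)).trans H
  induction ρ generalizing h with
  | nil => simpa [pendingWhileAlive] using hg.optOn_filter_le
  | cons r ρ ih =>
    rw [pendingWhileAlive]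
    split_ifs with h1 h2
    · simpa [h2] using ih h1
    · simpa [h2] using ih h1
    · simpa using hg.optOn_filter_le

variable {s}

/-- D pays for one candidate: a jump of all servers at its start and the run of the restarted
algorithm during its life. The cost of the current candidate is kept apart, since its run is already
under way. -/
theorem PartialAlgorithm.compose_costFrom_le (A : PartialAlgorithm M s) (ha : a ∉ s)
    (hw : ∀ l ∈ s, w l ≤ w a) {D : ℝ≥0}
    (hD : ∀ C σ, optOn s w σ ≤ threshold s w a →
      (((s.card + 1 : ℕ) * w a : ℝ≥0) : ℝ≥0∞) + A.costFrom w (A.start C) σ ≤ D)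
    (x : PhaseMemory A a) (ρ : List (Request M)) :
    (A.compose w ha).costFrom w x ρ ≤
      A.costFrom w x.sub (x.cand.pendingWhileAlive s w x.history ρ) +
        x.cand.changeCost s w D x.history ρ := by
  induction ρ generalizing x with
  | nil => simp [costFrom]
  | cons r ρ ih =>
    obtain ⟨h, g, m⟩ := x
    have hmove : ∀ C C' : Config M, (moveCostOn (insert a s) w C C' : ℝ≥0∞) ≤
        (((s.card + 1 : ℕ) * w a : ℝ≥0) : ℝ≥0∞) := by
      intro C C'
      have := moveCostOn_le_card_mul (insert a s) w (W := w a) (by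
        intro l hl
        rcases Finset.mem_insert.1 hl with rfl | hl
        · rfl
        · exact hw l hl) C C'
      rw [Finset.card_insert_of_notMem ha] at this
      exact_mod_cast this
    have hfresh : ∀ (h' : List (Request M)) (g' : Candidate M a), g'.IsAlive s w h' →
        (moveCostOn (insert a s) w (PhaseMemory.config ⟨h, g, m⟩)
          (PhaseMemory.config (⟨h', g', A.start r⟩ : PhaseMemory A a)) : ℝ≥0∞) +
          (A.compose w ha).costFrom w (⟨h', g', A.start r⟩ : PhaseMemory A a) ρ ≤
        D + g'.changeCost s w D h' ρ := by
      intro h' g' hg'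
      calc _ ≤ (((s.card + 1 : ℕ) * w a : ℝ≥0) : ℝ≥0∞) +
            (A.costFrom w (A.start r) (g'.pendingWhileAlive s w h' ρ) +
              g'.changeCost s w D h' ρ) := add_le_add (hmove _ _) (ih _)
        _ ≤ _ := by
          rw [← add_assoc]
          gcongr
          exact hD r _ (hg'.optOn_pendingWhileAlive_le s w ρ)
    change ∑' y, PhaseMemory.next w ⟨h, g, m⟩ r y * (_ + _) ≤ _
    simp only [PhaseMemory.next, Candidate.pendingWhileAlive, Candidate.changeCost]
    split_ifs with h1 h2 h3
    · rw [tsum_map_mul, costFrom]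
      have hone : ∑' m', A.next m r m' * (g.changeCost s w D (h ++ [r]) ρ : ℝ≥0∞) =
          g.changeCost s w D (h ++ [r]) ρ := by
        rw [ENNReal.tsum_mul_right, PMF.tsum_coe, one_mul]
      rw [← hone, ← ENNReal.tsum_add]
      refine ENNReal.tsum_le_tsum fun m' => ?_
      rw [← mul_add, add_assoc]
      gcongr
      · change moveCostOn _ _ (Function.update _ _ _) (Function.update _ _ _) ≤ _
        rw [moveCostOn_insert s w ha, moveCostOn_update s w ha]
        simp [uniformDist_self]
      · exact ih ⟨h ++ [r], g, m'⟩
    · rw [tsum_pure_mul]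
      change ((moveCostOn _ _ (PhaseMemory.config _) (PhaseMemory.config _) : ℝ≥0) : ℝ≥0∞) + _ ≤ _
      simp only [PhaseMemory.config, moveCostOn_self, ENNReal.coe_zero, zero_add]
      exact ih ⟨h ++ [r], g, m⟩
    · rw [tsum_map_mul, tsum_uniformOfFinset_mul]
      have hpos : 0 < h3.1.toFinset.card :=
        Finset.card_pos.2 (h3.1.toFinset_nonempty.2 h3.2)
      refine le_add_left (ENNReal.div_le_of_le_mul ?_)
      calc _ ≤ ∑ p ∈ h3.1.toFinset, ((D : ℝ≥0∞) +
            Candidate.changeCost s w D (h ++ [r]) (Sum.inr p : Candidate M a) ρ) :=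
          Finset.sum_le_sum fun p hp => hfresh _ _ (h3.1.mem_toFinset.1 hp)
        _ = _ := by
          rw [← ENNReal.coe_natCast]
          simp only [← ENNReal.coe_add, ← ENNReal.coe_mul, ← ENNReal.ofNNReal_finsetSum]
          rw [Finset.sum_add_distrib, add_mul, div_mul_cancel₀, Finset.sum_const, nsmul_eq_mul,
            mul_comm]
          exact_mod_cast hpos.ne'
    · rw [tsum_pure_mul]
      refine le_add_left ?_
      rw [ENNReal.coe_add]
      refine hfresh [] (Sum.inl (r a)) ?_
      have : Nonempty (Config M) := ⟨r⟩
      change optOn s w [] ≤ _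
      rw [optOn_nil]
      exact zero_le

end compose

/-! ### Phases: the offline lower bound and the expected number of candidates -/

section phases

variable (s : Finset (Fin k)) (w : Fin k → ℝ≥0) (a : Fin k)

/-- The requests `h` complete a phase: all candidates are dead. -/
def PhaseOver (h : List (Request M)) : Prop :=
  threshold s w a < optOn s w h ∧ alivePositions s w a h = ∅

open scoped Classical in
/-- The number of phases that are completed by the requests `ρ` if the current phase consists of
the requests `h` so far. -/
noncomputable def phaseCount : List (Request M) → List (Request M) → ℕ
  | _, [] => 0
  | h, r :: ρ =>
    if PhaseOver s w a (h ++ [r]) then phaseCount [] ρ + 1 else phaseCount (h ++ [r]) ρ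

/-- The bound on the cost of a phase of the algorithm. -/
noncomputable def phaseBound (D : ℝ≥0) : ℝ :=
  D * (2 + Real.log (errDen s.card))

variable {s w a}

/-- Here x is what the offline solution has already paid in the current phase. Either x has reached
w_a, or a has stayed at C a and `s` has served the pending requests within x, ending in C. At the
end of the phase C a is dead, so the second case also yields x ≥ w_a, and x restarts at 0. -/
theorem mul_phaseCount_le_add_optFrom (ha : a ∉ s) (ρ h : List (Request M)) (C : Config M)
    (x : ℝ≥0∞)
    (hx : w a ≤ x ∨ ∀ σ, optOn s w (h.filter (Candidate.isPending
      (Sum.inr (C a) : Candidate M a)) ++ σ) ≤ x + optFrom s w C σ) :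
    (w a : ℝ≥0∞) * phaseCount s w a h ρ ≤ x + optFrom (insert a s) w C ρ := by
  induction ρ generalizing h C x with
  | nil => simp [phaseCount]
  | cons r ρ ih =>
    rw [optFrom]
    simp only [ENNReal.add_iInf]
    refine le_iInf₂ fun C' hC' => ?_
    rw [← add_assoc]
    set x' := x + (moveCostOn (insert a s) w C C' : ℝ≥0∞) with hx'
    have key : w a ≤ x' ∨ ∀ σ, optOn s w ((h ++ [r]).filter (Candidate.isPending
        (Sum.inr (C' a) : Candidate M a)) ++ σ) ≤ x' + optFrom s w C' σ := by
      rcases hx with hx | hx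
      · exact Or.inl (hx.trans le_self_add)
      by_cases hCa : C a = C' a
      · right
        intro σ
        have hm : moveCostOn (insert a s) w C C' = moveCostOn s w C C' := by
          rw [moveCostOn_insert s w ha, hCa, uniformDist_self, zero_add]
        rw [hx', hm, add_assoc, ← hCa]
        by_cases hr : r a = C a
        · have h1 : ¬ Candidate.isPending (Sum.inr (C a) : Candidate M a) r := by
            simpa [Candidate.isPending] using hr
          rw [List.filter_append, List.filter_cons_of_neg h1, List.filter_nil, List.append_nil]
          refine (hx σ).trans ?_
          gcongr
          exact optFrom_le_add s w C C' σ
        · have h1 : Candidate.isPending (Sum.inr (C a) : Candidate M a) r := by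
            simpa [Candidate.isPending] using hr
          rw [List.filter_append, List.filter_cons_of_pos h1, List.filter_nil, List.append_assoc]
          refine (hx ([r] ++ σ)).trans ?_
          gcongr
          refine optFrom_cons_le s w ?_ σ
          rcases satisfiesOn_insert.1 hC' with h2 | h2
          · exact absurd (hCa.trans h2).symm hr
          · exact h2
      -- A single move of a already costs w_a.
      · left
        rw [hx', moveCostOn_insert s w ha, uniformDist_of_ne _ hCa, ENNReal.coe_add]
        exact le_self_add.trans le_add_self
    rw [phaseCount]
    split_ifs with hover
    · have hwx : (w a : ℝ≥0∞) ≤ x' := by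
        rcases key with h1 | h1
        · exact h1
        · have h2 := h1 []
          rw [List.append_nil, optFrom, add_zero] at h2
          refine le_trans ?_ h2
          have h3 : C' a ∉ alivePositions s w a (h ++ [r]) := by simp [hover.2]
          exact not_lt.1 h3
      have h4 := ih [] C' 0 (Or.inr fun σ => by simpa using optOn_le s w C' σ)
      rw [zero_add] at h4
      rw [Nat.cast_add, Nat.cast_one, mul_add, mul_one, add_comm]
      exact add_le_add hwx h4
    · exact ih _ _ _ key

theorem mul_phaseCount_le_optOn (ha : a ∉ s) (ρ : List (Request M)) :
    (w a : ℝ≥0∞) * phaseCount s w a [] ρ ≤ optOn (insert a s) w ρ :=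
  le_iInf fun C => by
    simpa using mul_phaseCount_le_add_optFrom ha ρ [] C 0
      (Or.inr fun σ => by simpa using optOn_le s w C σ)

theorem alivePositions_append_subset (h σ : List (Request M)) :
    alivePositions s w a (h ++ σ) ⊆ alivePositions s w a h :=
  fun p (hp : Candidate.IsAlive s w (h ++ σ) (Sum.inr p)) => hp.of_append

theorem le_phaseBound (D : ℝ≥0) : (D : ℝ) ≤ phaseBound s D := by
  have := Real.log_natCast_nonneg (errDen s.card)
  have hD := D.2
  change (0 : ℝ) ≤ D at hD
  unfold phaseBound
  nlinarith

/-- When j alive positions shrink to i, a random one dies with probability (j - i) / j; the drop of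
the logarithm pays for that redraw. -/
theorem sub_le_mul_log {i j : ℕ} (hi : 0 < i) (hj : 0 < j) :
    (j - i : ℝ) ≤ j * (Real.log j - Real.log i) := by
  have hi' : (0 : ℝ) < i := by exact_mod_cast hi
  have hj' : (0 : ℝ) < j := by exact_mod_cast hj
  rw [← Real.log_div hj'.ne' hi'.ne']
  have := Real.one_sub_inv_le_log_of_pos (div_pos hj' hi')
  calc (j - i : ℝ) = j * (1 - ((j : ℝ) / i)⁻¹) := by field_simp
    _ ≤ _ := by gcongr

/-- The two bounds are proved together, as resting and random candidates alternate. The second one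
sums over all alive positions, because a survivor of a uniform draw is uniform among the survivors.
In 1 + log the summand 1 pays for the change that opens the next phase; the 2 in `phaseBound` also
pays for leaving the resting candidate. -/
theorem changeCost_le (D : ℝ≥0) (ρ h : List (Request M)) :
    (∀ q : M a, (Candidate.changeCost s w D h (Sum.inl q) ρ : ℝ) ≤
      phaseBound s D * (phaseCount s w a h ρ + 1)) ∧
    ∀ P : Finset (M a), (P : Set (M a)) = alivePositions s w a h →
      threshold s w a < optOn s w h →
      ∑ p ∈ P, (Candidate.changeCost s w D h (Sum.inr p) ρ : ℝ) ≤
        P.card * (D * (1 + Real.log P.card) + phaseBound s D * phaseCount s w a h ρ) := by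
  classical
  have hB := le_phaseBound (s := s) D
  have hD : (0 : ℝ) ≤ D := D.2
  induction ρ generalizing h with
  | nil =>
    refine ⟨fun q => ?_, fun P _ _ => ?_⟩
    · simp only [Candidate.changeCost, phaseCount, NNReal.coe_zero]
      nlinarith
    · simp only [Candidate.changeCost, phaseCount, NNReal.coe_zero]
      have := Real.log_natCast_nonneg P.card
      simp only [Finset.sum_const_zero]
      have : (0 : ℝ) ≤ P.card := Nat.cast_nonneg _
      simp only [Nat.cast_zero, mul_zero, add_zero]
      positivity
  | cons r ρ ih =>
    set h' := h ++ [r] with hh'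
    by_cases hgen : threshold s w a < optOn s w h'
    swap
    · have hal : ∀ q : M a, Candidate.IsAlive s w h' (Sum.inl q : Candidate M a) :=
        fun q => not_lt.1 hgen
      refine ⟨fun q => ?_, fun P _ hP => ?_⟩
      · rw [Candidate.changeCost, if_pos (hal q), phaseCount, if_neg fun h => hgen h.1]
        exact (ih h').1 q
      · exact absurd (hP.trans_le (optOn_mono s w (List.sublist_append_left h [r]))) hgen
    have hdead : ∀ q : M a, ¬ Candidate.IsAlive s w h' (Sum.inl q : Candidate M a) :=
      fun q => not_le.2 hgen
    have hfin := finite_alivePositions s w hgen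
    rcases (alivePositions s w a h').eq_empty_or_nonempty with hem | hne
    · have hover : PhaseOver s w a h' := ⟨hgen, hem⟩
      have hcost : ∀ g : Candidate M a, ¬ g.IsAlive s w h' →
          (g.changeCost s w D h (r :: ρ) : ℝ) ≤
            D + phaseBound s D * (phaseCount s w a h (r :: ρ)) := by
        intro g hg
        rw [Candidate.changeCost, if_neg hg, dif_neg fun h => h.2.ne_empty hem, phaseCount,
          if_pos hover, NNReal.coe_add, Nat.cast_add, Nat.cast_one]
        gcongr
        exact (ih []).1 (r a)
      refine ⟨fun q => (hcost _ (hdead q)).trans (by nlinarith), fun P hP _ => ?_⟩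
      rw [← nsmul_eq_mul]
      refine Finset.sum_le_card_nsmul _ _ _ fun p hp => ?_
      have hpd : ¬ Candidate.IsAlive s w h' (Sum.inr p : Candidate M a) := fun hp' =>
        (hem ▸ (show p ∈ alivePositions s w a h' from hp') : p ∈ (∅ : Set (M a)))
      refine (hcost _ hpd).trans ?_
      have := mul_nonneg hD (Real.log_natCast_nonneg P.card)
      nlinarith
    · have hcond : (alivePositions s w a h').Finite ∧ (alivePositions s w a h').Nonempty :=
        ⟨hfin, hne⟩
      have hnot : ¬ PhaseOver s w a h' := fun h => hne.ne_empty h.2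
      set P' := hcond.1.toFinset with hP'
      have hP'ne : P'.Nonempty := hcond.1.toFinset_nonempty.2 hne
      have hP'pos : (0 : ℝ) < P'.card := by exact_mod_cast hP'ne.card_pos
      have hsum := (ih h').2 P' (by simp [hP']) hgen
      set N := phaseCount s w a h' ρ
      set S := ∑ p ∈ P', (Candidate.changeCost s w D h' (Sum.inr p) ρ : ℝ) with hS
      have hcount : phaseCount s w a h (r :: ρ) = N := by rw [phaseCount, if_neg hnot]
      have hcost : ∀ g : Candidate M a, ¬ g.IsAlive s w h' →
          (g.changeCost s w D h (r :: ρ) : ℝ) = D + S / P'.card := by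
        intro g hg
        rw [Candidate.changeCost, if_neg hg, dif_pos hcond]
        push_cast
        rfl
      have havg : S / P'.card ≤ D * (1 + Real.log P'.card) + phaseBound s D * N := by
        rw [div_le_iff₀ hP'pos]
        linarith
      rw [hcount]
      refine ⟨fun q => ?_, fun P hP _ => ?_⟩
      · rw [hcost _ (hdead q)]
        have hcard : P'.card < errDen s.card :=
          card_lt_errDen s w hgen P' fun p hp => hcond.1.mem_toFinset.1 hp
        have hlog : Real.log P'.card ≤ Real.log (errDen s.card) :=
          Real.log_le_log hP'pos (by exact_mod_cast hcard.le)
        have h1 := mul_le_mul_of_nonneg_left hlog hD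
        have h2 : phaseBound s D = D * (2 + Real.log (errDen s.card)) := rfl
        rw [mul_add_one]
        linarith
      · have hsub : P' ⊆ P := by
          rw [← Finset.coe_subset, hP, hP', Set.Finite.coe_toFinset]
          exact alivePositions_append_subset h [r]
        have h1 : ∑ p ∈ P', (Candidate.changeCost s w D h (Sum.inr p) (r :: ρ) : ℝ) = S := by
          refine Finset.sum_congr rfl fun p hp => ?_
          have : Candidate.IsAlive s w h' (Sum.inr p : Candidate M a) :=
            hcond.1.mem_toFinset.1 hp
          rw [Candidate.changeCost, if_pos this]
        have h2 : ∑ p ∈ P \ P', (Candidate.changeCost s w D h (Sum.inr p) (r :: ρ) : ℝ) =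
            (P.card - P'.card) * (D + S / P'.card) := by
          rw [Finset.sum_congr rfl fun p hp => hcost (Sum.inr p) fun hal =>
            (Finset.mem_sdiff.1 hp).2 (hcond.1.mem_toFinset.2 hal), Finset.sum_const,
            nsmul_eq_mul, Finset.cast_card_sdiff hsub]
        rw [← Finset.sum_sdiff hsub, h1, h2]
        have hPpos : 0 < P.card := hP'ne.card_pos.trans_le (Finset.card_le_card hsub)
        have h3 := mul_le_mul_of_nonneg_right (sub_le_mul_log hP'ne.card_pos hPpos) hD
        have h4 : S = P'.card * (S / P'.card) := by field_simp
        have h5 := mul_le_mul_of_nonneg_left havg (Nat.cast_nonneg (α := ℝ) P.card)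
        -- Dead positions pay D and the average of the survivors, so all of P carries that average
        -- and only |P| - |P'| positions pay D.
        calc (P.card - P'.card) * (D + S / P'.card) + S
            = P.card * (S / P'.card) + (P.card - P'.card) * D := by
              nth_rewrite 2 [h4]
              ring
          _ ≤ _ := by linarith

end phases

/-! ### The induction over the servers and the growth of the ratio -/

/-- The trivial algorithm that uses no server at all. -/
noncomputable def PartialAlgorithm.idle (M : Fin k → Type u) : PartialAlgorithm M ∅ where
  Memory := Config M
  config := id
  start := id
  next C _ := PMF.pure C
  config_start _ := rfl
  satisfies_next h := absurd rfl h.ne_empty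

theorem PartialAlgorithm.idle_costFrom (w : Fin k → ℝ≥0) (C : Config M)
    (ρ : List (Request M)) : (idle M).costFrom w C ρ = 0 := by
  induction ρ with
  | nil => rfl
  | cons r ρ ih =>
    change ∑' C', PMF.pure C C' * _ = _
    rw [tsum_pure_mul, ih]
    simp [idle, moveCostOn_self]

theorem eight_mul_errDen (m : ℕ) : (8 * errDen m : ℝ) = 16 ^ 2 ^ m := by
  induction m with
  | zero => norm_num [errDen]
  | succ m ih =>
    rw [pow_succ 2, pow_mul, ← ih, errDen]
    push_cast
    ring

theorem log_errDen_le (m : ℕ) : Real.log (errDen m) ≤ 3 * 2 ^ m := by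
  have h2 : (0 : ℝ) < errDen m := by exact_mod_cast (two_le_errDen m).trans_lt' (by norm_num)
  calc Real.log (errDen m) ≤ Real.log (16 ^ 2 ^ m) := by
        refine Real.log_le_log h2 ?_
        rw [← eight_mul_errDen]
        linarith
    _ = 2 ^ m * Real.log 16 := by rw [Real.log_pow]; push_cast; rfl
    _ ≤ 2 ^ m * 3 := by
        gcongr
        rw [show (16 : ℝ) = 2 ^ 4 by norm_num, Real.log_pow]
        have := Real.log_two_lt_d9
        norm_num
        linarith
    _ = _ := mul_comm _ _

/-- The growth of the competitive ratio with the number of servers. -/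
theorem ratio_succ_le (m : ℕ) :
    ((m + 1 : ℝ) + 160 ^ m ^ 2 * (4 ^ m + 2)) * (2 + 3 * 2 ^ m) ≤ (160 : ℝ) ^ (m + 1) ^ 2 := by
  have h1 : (1 : ℝ) ≤ 160 ^ m ^ 2 := one_le_pow₀ (by norm_num)
  have h2 : (m + 1 : ℝ) ≤ 4 ^ m := by
    exact_mod_cast (Nat.lt_pow_self (by norm_num : 1 < 4) : m < 4 ^ m)
  have h3 : (1 : ℝ) ≤ 4 ^ m := one_le_pow₀ (by norm_num)
  have h4 : (1 : ℝ) ≤ 2 ^ m := one_le_pow₀ (by norm_num)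
  calc ((m + 1 : ℝ) + 160 ^ m ^ 2 * (4 ^ m + 2)) * (2 + 3 * 2 ^ m)
      ≤ (160 ^ m ^ 2 * 4 ^ m + 160 ^ m ^ 2 * (4 ^ m + 2 * 4 ^ m)) * (2 * 2 ^ m + 3 * 2 ^ m) := by
        gcongr
        · nlinarith
        · linarith
        · linarith
    _ = 160 ^ m ^ 2 * (20 * (4 ^ m * 2 ^ m)) := by ring
    _ = 160 ^ m ^ 2 * (20 * 8 ^ m) := by rw [← mul_pow]; norm_num
    _ ≤ 160 ^ m ^ 2 * (160 * 160 ^ (2 * m)) := by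
        gcongr
        · norm_num
        · calc (8 : ℝ) ^ m ≤ 160 ^ m := by gcongr; norm_num
            _ ≤ 160 ^ (2 * m) := pow_le_pow_right₀ (by norm_num) (by omega)
    _ = _ := by ring

/-- The additive term scales with a bound W on the weights in `s`. In the induction W is the weight
of the new server, so every restart of the inner algorithm costs only a multiple of w_a. -/
theorem exists_partialAlgorithm (w : Fin k → ℝ≥0) (s : Finset (Fin k)) :
    ∀ W : ℝ≥0, (∀ l ∈ s, w l ≤ W) → ∃ A : PartialAlgorithm M s, ∀ C ρ,
      A.costFrom w (A.start C) ρ ≤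
        ((160 ^ s.card ^ 2 : ℝ≥0) : ℝ≥0∞) * optOn s w ρ +
          ((2 * 160 ^ s.card ^ 2 * W : ℝ≥0) : ℝ≥0∞) := by
  induction s using Finset.induction_on_max_value w with
  | empty =>
    exact fun W _ => ⟨PartialAlgorithm.idle M, fun C ρ => by
      exact (PartialAlgorithm.idle_costFrom w C ρ).trans_le zero_le⟩
  | insert a s ha hw ih =>
    intro W hW
    obtain ⟨A, hA⟩ := ih (w a) hw
    set α : ℝ≥0 := 160 ^ s.card ^ 2 with hα
    set β : ℝ≥0 := 160 ^ (insert a s).card ^ 2 with hβ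
    -- The summands are the initial jump, the ratio α times the threshold, and the additive term of
    -- the inner algorithm.
    set D : ℝ≥0 := ((s.card + 1 : ℕ) + α * (4 ^ s.card + 2)) * w a with hD
    have hfresh : ∀ C σ, optOn s w σ ≤ threshold s w a →
        (((s.card + 1 : ℕ) * w a : ℝ≥0) : ℝ≥0∞) + A.costFrom w (A.start C) σ ≤ D := by
      intro C σ hσ
      calc _ ≤ (((s.card + 1 : ℕ) * w a : ℝ≥0) : ℝ≥0∞) +
            ((α : ℝ≥0∞) * threshold s w a + (2 * α * w a : ℝ≥0)) := by
            gcongr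
            exact (hA C σ).trans (by gcongr)
        _ = D := by
            rw [← ENNReal.coe_mul, ← ENNReal.coe_add, ← ENNReal.coe_add, ENNReal.coe_inj, hD,
              threshold]
            ring
    have hphase : phaseBound s D ≤ β * w a := by
      rw [hβ, Finset.card_insert_of_notMem ha]
      have h1 := ratio_succ_le s.card
      have h2 := log_errDen_le s.card
      have hwa : (0 : ℝ) ≤ w a := NNReal.coe_nonneg _
      rw [phaseBound, hD, hα]
      push_cast
      calc _ ≤ ((s.card + 1 : ℝ) + 160 ^ s.card ^ 2 * (4 ^ s.card + 2)) * w a *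
            (2 + 3 * 2 ^ s.card) := by gcongr
        _ = ((s.card + 1 : ℝ) + 160 ^ s.card ^ 2 * (4 ^ s.card + 2)) *
            (2 + 3 * 2 ^ s.card) * w a := by ring
        _ ≤ _ := by gcongr
    have hDβ : D ≤ β * w a := by
      rw [← NNReal.coe_le_coe]
      exact (le_phaseBound D).trans (by exact_mod_cast hphase)
    have hwW : w a ≤ W := hW a (Finset.mem_insert_self a s)
    refine ⟨A.compose w ha, fun C ρ => ?_⟩
    refine (A.compose_costFrom_le w ha hw hfresh _ ρ).trans ?_
    have : Nonempty (Config M) := ⟨C⟩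
    have hstart : Candidate.IsAlive s w [] (Sum.inl (C a) : Candidate M a) := by
      change optOn s w [] ≤ _
      rw [optOn_nil]
      exact zero_le
    have h1 : A.costFrom w (A.start C)
        (Candidate.pendingWhileAlive s w [] (Sum.inl (C a) : Candidate M a) ρ) ≤ D :=
      le_add_self.trans (hfresh C _ (hstart.optOn_pendingWhileAlive_le s w ρ))
    have h2 : Candidate.changeCost s w D [] (Sum.inl (C a) : Candidate M a) ρ ≤
        β * w a * (phaseCount s w a [] ρ + 1) := by
      rw [← NNReal.coe_le_coe]
      refine ((changeCost_le D ρ []).1 (C a)).trans ?_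
      push_cast
      gcongr
    calc _ ≤ (D : ℝ≥0∞) + ((β * w a * (phaseCount s w a [] ρ + 1) : ℝ≥0) : ℝ≥0∞) :=
          add_le_add h1 (ENNReal.coe_le_coe.2 h2)
      _ ≤ ((β * w a : ℝ≥0) : ℝ≥0∞) +
          ((β * w a * (phaseCount s w a [] ρ + 1) : ℝ≥0) : ℝ≥0∞) := by gcongr
      -- One β w_a covers the very first candidate, the other the unfinished last phase.
      _ = β * (w a * phaseCount s w a [] ρ) + ((2 * β * w a : ℝ≥0) : ℝ≥0∞) := by
          push_cast
          ring
      _ ≤ _ := by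
          gcongr
          exact mul_phaseCount_le_optOn ha ρ

/-- An algorithm that uses all servers, started in a given configuration. -/
def PartialAlgorithm.toRandomizedOnlineAlgorithm [Nonempty (Fin k)]
    (A : PartialAlgorithm M Finset.univ) (C₀ : Config M) : RandomizedOnlineAlgorithm M C₀ where
  Memory := A.Memory
  config := A.config
  start := A.start C₀
  next := A.next
  config_start := A.config_start C₀
  satisfies_next m r m' hm' :=
    (A.satisfies_next Finset.univ_nonempty m r m' hm').imp fun _ h => h.2

theorem PartialAlgorithm.expectedCostFrom_toRandomizedOnlineAlgorithm [Nonempty (Fin k)]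
    (A : PartialAlgorithm M Finset.univ) (C₀ : Config M) (w : Fin k → ℝ≥0) (m : A.Memory)
    (ρ : List (Request M)) :
    (A.toRandomizedOnlineAlgorithm C₀).expectedCostFrom w m ρ = A.costFrom w m ρ := by
  induction ρ generalizing m with
  | nil => rfl
  | cons r ρ ih =>
    refine tsum_congr fun m' => ?_
    exact congrArg (fun c : ℝ≥0∞ => A.next m r m' *
      ((moveCost w (A.config m) (A.config m') : ℝ≥0∞) + c)) (ih m')

end GeneralizedKServer

/-- There is a randomized online algorithm for the generalized `k`-server problem on weighted
uniform metrics with competitive ratio `exp(O(k ^ 2))`; the additive constant `c'` depends on `k`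
and on the weights only. -/
theorem theorem2 :
    ∃ K : ℝ, ∀ k : ℕ, 1 ≤ k → ∀ w : Fin k → ℝ≥0, ∃ c' : ℝ≥0,
      ∀ (M : Fin k → Type u) (C₀ : GeneralizedKServer.Config M),
        ∃ A : GeneralizedKServer.RandomizedOnlineAlgorithm M C₀,
          ∀ ρ : List (GeneralizedKServer.Request M),
            A.expectedCost w ρ ≤
              ENNReal.ofReal (Real.exp (K * (k : ℝ) ^ 2)) * GeneralizedKServer.OPT w ρ + c' := by
  refine ⟨Real.log 160, fun k hk w => ⟨2 * 160 ^ k ^ 2 * ∑ l, w l, fun M C₀ => ?_⟩⟩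
  have : Nonempty (Fin k) := ⟨⟨0, hk⟩⟩
  obtain ⟨A, hA⟩ := GeneralizedKServer.exists_partialAlgorithm (M := M) w Finset.univ (∑ l, w l)
    fun l hl => Finset.single_le_sum (fun _ _ => zero_le) hl
  refine ⟨A.toRandomizedOnlineAlgorithm C₀, fun ρ => ?_⟩
  have hexp : ENNReal.ofReal (Real.exp (Real.log 160 * (k : ℝ) ^ 2)) =
      ((160 ^ k ^ 2 : ℝ≥0) : ℝ≥0∞) := by
    have h : Real.exp (Real.log 160 * (k : ℝ) ^ 2) = ((160 ^ k ^ 2 : ℝ≥0) : ℝ) := by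
      rw [← Real.rpow_def_of_pos (by norm_num)]
      exact_mod_cast Real.rpow_natCast 160 (k ^ 2)
    rw [h, ENNReal.ofReal_coe_nnreal]
  rw [hexp]
  have h := hA C₀ ρ
  rw [Finset.card_univ, Fintype.card_fin] at h
  calc (A.toRandomizedOnlineAlgorithm C₀).expectedCost w ρ
      = A.costFrom w (A.start C₀) ρ :=
        A.expectedCostFrom_toRandomizedOnlineAlgorithm C₀ w (A.start C₀) ρ
    _ ≤ _ := h.trans (by
        gcongr
        exact GeneralizedKServer.optOn_univ_le_OPT w ρ)
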